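/- Let $\Omega\subset\mathbb C$ and let $M:\Omega\to\mathbb C^{n\times n}$ be analytic (that is, analytic in a neighborhood of every point of $\Omega$). A number $\mu\in\Omega$ is an eigenvalue of $M$ if $M(\mu)v=0$ for some $v\ne 0$; such a $v$ is a right eigenvector, and $u\neq 0$ with $u^HM(\mu)=0$ is a left eigenvector. The eigenvalue is simple if it is a simple zero of $\det M$. Let $\Gamma$ be a simple closed, piecewise-smooth, positively oriented curve which, together with its interior $\operatorname{int}(\Gamma)$, is contained in $\Omega$. Suppose that no eigenvalue of $M$ lies on $\Gamma$ and that all eigenvalues of $M$ in $\operatorname{int}(\Gamma)$ are simple. Then there are only finitely many eigenvalues in $\operatorname{int}(\Gamma)$. Let $\lambda_1,\dots,\lambda_k$ be these eigenvalues, listed without repetition, and let $v_i$ and $u_i$ be any right and left eigenvectors for $\lambda_i$. Then $u_i^HM'(\lambda_i)v_i\neq 0$ for all $i$; there is a function $R_\Gamma:\operatorname{int}(\Gamma)\to\mathbb C^{n\times n}$, analytic in $\operatorname{int}(\Gamma)$, with $$M(z)^{-1}=\sum_{i=1}^k\frac{1}{z-\lambda_i}\,\frac{v_iu_i^H}{u_i^HM'(\lambda_i)v_i}+R_\Gamma(z)\qquad\text{for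 all } z\in\operatorname{int}(\Gamma)\setminus\{\lambda_1,\dots,\lambda_k\};$$ and every such function satisfies $$R_\Gamma(z)=\frac{1}{2\pi\mathrm i}\oint_\Gamma\frac{M(\lambda)^{-1}}{\lambda-z}\,\mathrm d\lambda\qquad\text{for all } z\in\operatorname{int}(\Gamma),$$ where the integral exists. -/

import Mathlib

noncomputable section

/-- A simple closed piecewise-smooth curve in the complex plane, given by a parametrization
`toFun` on `[a, b]`: continuous, closed, injective on `[a, b)`, and continuously differentiable
(one-sidedly at the end points) on each of the finitely many pieces of a subdivision
`a = t 0 < t 1 < ... < t m = b`. -/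
structure SimpleClosedCurve where
  a : ℝ
  b : ℝ
  a_lt_b : a < b
  toFun : ℝ → ℂ
  continuousOn : ContinuousOn toFun (Set.Icc a b)
  closed : toFun a = toFun b
  simple : Set.InjOn toFun (Set.Ico a b)
  piecewise_smooth : ∃ (m : ℕ) (t : ℕ → ℝ), t 0 = a ∧ t m = b ∧
    ∀ i < m, t i < t (i + 1) ∧ ContDiffOn ℝ 1 toFun (Set.Icc (t i) (t (i + 1)))

namespace SimpleClosedCurve

/-- The point set traced out by the curve. -/
def carrier (Γ : SimpleClosedCurve) : Set ℂ := Γ.toFun '' Set.Icc Γ.a Γ.b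

/-- The interior of the curve: the points off the curve that lie in a bounded connected
component of its complement. -/
def interior (Γ : SimpleClosedCurve) : Set ℂ :=
  {z | z ∈ Γ.carrierᶜ ∧ Bornology.IsBounded (connectedComponentIn Γ.carrierᶜ z)}

/-- The integrand of the contour integral of `f`, pulled back to the parameter interval, is
integrable. -/
def ContourIntegrable (Γ : SimpleClosedCurve) (f : ℂ → ℂ) : Prop :=
  IntervalIntegrable (fun t => f (Γ.toFun t) * deriv Γ.toFun t) MeasureTheory.volume Γ.a Γ.b

/-- The contour integral of `f` along the curve. The derivative may fail to exist only at the
finitely many break points, which do not affect the integral. -/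
def contourIntegral (Γ : SimpleClosedCurve) (f : ℂ → ℂ) : ℂ :=
  ∫ t in Γ.a..Γ.b, f (Γ.toFun t) * deriv Γ.toFun t

/-- The winding number of the curve about `z` (for `z` off the curve). -/
def windingNumber (Γ : SimpleClosedCurve) (z : ℂ) : ℂ :=
  (2 * Real.pi * Complex.I)⁻¹ * Γ.contourIntegral (fun w => (w - z)⁻¹)

/-- The curve is positively oriented (counterclockwise): it winds once, in the positive sense,
around the points of its interior. -/
def PositivelyOriented (Γ : SimpleClosedCurve) : Prop :=
  ∀ z ∈ Γ.interior, Γ.windingNumber z = 1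

end SimpleClosedCurve

/-- The matrix-valued function `M` is analytic on (a neighborhood of each point of) `s`. -/
def MatrixAnalyticOn {n : ℕ} (M : ℂ → Matrix (Fin n) (Fin n) ℂ) (s : Set ℂ) : Prop :=
  ∀ i j, AnalyticOnNhd ℂ (fun z => M z i j) s

/-- The derivative `M'(z)`. -/
def matrixDeriv {n : ℕ} (M : ℂ → Matrix (Fin n) (Fin n) ℂ) (z : ℂ) : Matrix (Fin n) (Fin n) ℂ :=
  Matrix.of fun i j => deriv (fun w => M w i j) z

/-- `v` is a (right) eigenvector for `μ`: `M(μ) v = 0`, `v ≠ 0`. -/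
def IsRightEigenvector {n : ℕ} (M : ℂ → Matrix (Fin n) (Fin n) ℂ) (μ : ℂ) (v : Fin n → ℂ) :
    Prop :=
  v ≠ 0 ∧ Matrix.mulVec (M μ) v = 0

/-- `u` is a left eigenvector for `μ`: `uᴴ M(μ) = 0`, `u ≠ 0`. -/
def IsLeftEigenvector {n : ℕ} (M : ℂ → Matrix (Fin n) (Fin n) ℂ) (μ : ℂ) (u : Fin n → ℂ) :
    Prop :=
  u ≠ 0 ∧ Matrix.vecMul (star u) (M μ) = 0

/-- `μ` is an eigenvalue of the nonlinear eigenvalue problem `M(μ) v = 0`, `v ≠ 0`. -/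
def IsNEPEigenvalue {n : ℕ} (M : ℂ → Matrix (Fin n) (Fin n) ℂ) (μ : ℂ) : Prop :=
  ∃ v, IsRightEigenvector M μ v

/-- The eigenvalue `μ` is simple: its algebraic multiplicity, the order of `μ` as a zero of
`det M`, is one. -/
def IsSimpleEigenvalue {n : ℕ} (M : ℂ → Matrix (Fin n) (Fin n) ℂ) (μ : ℂ) : Prop :=
  IsNEPEigenvalue M μ ∧ analyticOrderAt (fun z => (M z).det) μ = 1

/-- The number `uᴴ M'(μ) v`. -/
def eigenPairing {n : ℕ} (M : ℂ → Matrix (Fin n) (Fin n) ℂ) (μ : ℂ) (v u : Fin n → ℂ) : ℂ :=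
  dotProduct (star u) (Matrix.mulVec (matrixDeriv M μ) v)

/-- The principal part in Keldysh's theorem,
`∑ i, (z - lam i)⁻¹ • (v i (u i)ᴴ) / ((u i)ᴴ M'(lam i) v i)`. -/
def keldyshSum {n k : ℕ} (M : ℂ → Matrix (Fin n) (Fin n) ℂ) (lam : Fin k → ℂ)
    (v u : Fin k → Fin n → ℂ) (z : ℂ) : Matrix (Fin n) (Fin n) ℂ :=
  ∑ i, ((z - lam i)⁻¹ * (eigenPairing M (lam i) (v i) (u i))⁻¹) •
    Matrix.vecMulVec (v i) (star (u i))

/-- `R` is a remainder in Keldysh's theorem for the eigentriplets `(lam i, v i, u i)` inside `Γ`: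
it is analytic in the interior of `Γ`, and `M(z)⁻¹` is the sum of the principal part and `R(z)`
at all points `z` of the interior other than the `lam i`. -/
def IsKeldyshRemainder {n k : ℕ} (M : ℂ → Matrix (Fin n) (Fin n) ℂ) (Γ : SimpleClosedCurve)
    (lam : Fin k → ℂ) (v u : Fin k → Fin n → ℂ) (R : ℂ → Matrix (Fin n) (Fin n) ℂ) : Prop :=
  MatrixAnalyticOn R Γ.interior ∧
    ∀ z ∈ Γ.interior \ Set.range lam, (M z)⁻¹ = keldyshSum M lam v u z + R z

/-- The matrix `(2 π i)⁻¹ ∮_Γ M(w)⁻¹ / (w - z) dw` (integrated entry by entry). -/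
def cauchyInverse {n : ℕ} (M : ℂ → Matrix (Fin n) (Fin n) ℂ) (Γ : SimpleClosedCurve) (z : ℂ) :
    Matrix (Fin n) (Fin n) ℂ :=
  Matrix.of fun i j =>
    (2 * Real.pi * Complex.I)⁻¹ * Γ.contourIntegral (fun w => (M w)⁻¹ i j / (w - z))

end

open Filter Topology Set

/-! Near a simple eigenvalue `μ`, write `M⁻¹ = adj M / det M`, where `det M = (z - μ) g` with `g μ =
(det M)'(μ) ≠ 0`. The pole is simple with residue `adj M(μ) / g μ`. As `adj M(μ)` is a multiple of
`v uᴴ`, differentiating `uᴴ M adj M = det M uᴴ` at `μ` determines the multiple and shows `uᴴ M'(μ) v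
≠ 0` (`exists_adjugate_eq_smul_of_simple`). Subtracting all principal parts therefore leaves
removable singularities, and the filled-in difference `S` is analytic on a neighborhood of the curve
and its interior. Cauchy's formula (`contourIntegral_div_sub_eq`) recovers `S` from its values on
the curve, where `S` is `M⁻¹` minus the principal part. The principal part contributes nothing to
that integral (`contourIntegral_inv_sub_div_sub`), so `M⁻¹` can replace `S` under it. -/

/-! ### Adjugates of singular matrices. -/

/-- A nonzero entry `(i, j)` of the adjugate says that replacing row `j` by the `i`-th unit vector
gives an invertible matrix. A kernel vector with vanishing `i`-th coordinate is killed by it, so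
this coordinate is injective on the kernel. -/
theorem Matrix.exists_eq_smul_of_mulVec_eq_zero {ι K : Type*} [Fintype ι]
    [DecidableEq ι] [Field K] {A : Matrix ι ι K} (hA : A.adjugate ≠ 0) {v : ι → K} (hv : v ≠ 0)
    (hAv : A.mulVec v = 0) :
    ∃ i, v i ≠ 0 ∧ ∀ x, A.mulVec x = 0 → x = (x i / v i) • v := by
  obtain ⟨i, j, hij⟩ : ∃ i j, A.adjugate i j ≠ 0 := by
    by_contra! h
    exact hA (Matrix.ext h)
  rw [Matrix.adjugate_apply] at hij
  have key : ∀ x, A.mulVec x = 0 → x i = 0 → x = 0 := by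
    intro x hx hxi
    refine Matrix.eq_zero_of_mulVec_eq_zero hij ?_
    ext l
    by_cases hl : l = j
    · subst hl
      simp [Matrix.mulVec, hxi]
    · have := congrFun hx l
      simpa [Matrix.mulVec, Matrix.updateRow_ne hl] using this
  have hvi : v i ≠ 0 := fun h => hv (key v hAv h)
  refine ⟨i, hvi, fun x hx => ?_⟩
  rw [← sub_eq_zero]
  apply key
  · rw [Matrix.mulVec_sub, Matrix.mulVec_smul, hx, hAv]; simp
  · simp [hvi]

/-- Since `A` is singular, the columns of its adjugate lie in the kernel and the rows in the left
kernel; both are lines unless the adjugate vanishes, in which case `c = 0`. -/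
theorem Matrix.adjugate_eq_smul_vecMulVec {ι K : Type*} [Fintype ι]
    [DecidableEq ι] [Field K] {A : Matrix ι ι K} {v w : ι → K} (hv : v ≠ 0) (hw : w ≠ 0)
    (hAv : A.mulVec v = 0) (hwA : A.vecMul w = 0) :
    ∃ c : K, A.adjugate = c • Matrix.vecMulVec v w := by
  by_cases hA : A.adjugate = 0
  · exact ⟨0, by simp [hA]⟩
  have hdet : A.det = 0 := Matrix.exists_mulVec_eq_zero_iff.1 ⟨v, hv, hAv⟩
  obtain ⟨i, hvi, hi⟩ := Matrix.exists_eq_smul_of_mulVec_eq_zero hA hv hAv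
  have hAt : A.transpose.adjugate ≠ 0 := by
    rw [← Matrix.adjugate_transpose]
    simpa using hA
  obtain ⟨j, hwj, hj⟩ := Matrix.exists_eq_smul_of_mulVec_eq_zero hAt hw
    (by rwa [Matrix.mulVec_transpose])
  have hcol : ∀ p q, A.adjugate p q = A.adjugate i q / v i * v p := by
    intro p q
    have h := hi (fun p => A.adjugate p q) (by
      ext l
      have := congrFun (congrFun (Matrix.mul_adjugate A) l) q
      simpa [hdet, Matrix.mul_apply, Matrix.mulVec, dotProduct] using this)
    exact congrFun h p
  have hrow : ∀ p q, A.adjugate p q = A.adjugate p j / w j * w q := by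
    intro p q
    have h := hj (fun q => A.adjugate p q) (by
      rw [Matrix.mulVec_transpose]
      ext l
      have := congrFun (congrFun (Matrix.adjugate_mul A) p) l
      simpa [hdet, Matrix.mul_apply, Matrix.vecMul, dotProduct] using this)
    exact congrFun h q
  refine ⟨A.adjugate i j / v i / w j, ?_⟩
  ext p q
  rw [hcol p q, hrow i q]
  simp only [Matrix.smul_apply, Matrix.vecMulVec_apply, smul_eq_mul]
  ring

/-! ### The inverse of `M` near a simple eigenvalue. -/

section

variable {n : ℕ} {M : ℂ → Matrix (Fin n) (Fin n) ℂ} {μ : ℂ}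

theorem AnalyticAt.matrix_det {ι : Type*} [Fintype ι] [DecidableEq ι] {N : ℂ → Matrix ι ι ℂ}
    {μ : ℂ} (h : ∀ i j, AnalyticAt ℂ (fun z => N z i j) μ) :
    AnalyticAt ℂ (fun z => (N z).det) μ := by
  simp only [Matrix.det_apply']
  refine Finset.analyticAt_fun_sum _ fun σ _ => analyticAt_const.mul ?_
  exact Finset.analyticAt_fun_prod _ fun i _ => h _ _

theorem AnalyticAt.matrix_adjugate {ι : Type*} [Fintype ι] [DecidableEq ι] {N : ℂ → Matrix ι ι ℂ}
    {μ : ℂ} (h : ∀ i j, AnalyticAt ℂ (fun z => N z i j) μ) (i j : ι) :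
    AnalyticAt ℂ (fun z => (N z).adjugate i j) μ := by
  simp only [Matrix.adjugate_apply]
  refine AnalyticAt.matrix_det fun p q => ?_
  by_cases hp : p = j
  · subst hp
    simpa using analyticAt_const
  · simpa [Matrix.updateRow_ne hp] using h p q

theorem isNEPEigenvalue_iff : IsNEPEigenvalue M μ ↔ (M μ).det = 0 :=
  Matrix.exists_mulVec_eq_zero_iff

theorem analyticAt_inv_apply (h : ∀ i j, AnalyticAt ℂ (fun z => M z i j) μ)
    (hμ : ¬ IsNEPEigenvalue M μ) (i j : Fin n) : AnalyticAt ℂ (fun z => (M z)⁻¹ i j) μ := by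
  rw [isNEPEigenvalue_iff] at hμ
  simp only [Matrix.inv_def, Ring.inverse_eq_inv', Matrix.smul_apply, smul_eq_mul]
  exact ((AnalyticAt.matrix_det h).inv hμ).mul (AnalyticAt.matrix_adjugate h i j)

theorem exists_adjugate_eq_smul_of_simple (h : ∀ i j, AnalyticAt ℂ (fun z => M z i j) μ)
    (hd : deriv (fun z => (M z).det) μ ≠ 0) {v u : Fin n → ℂ}
    (hv : IsRightEigenvector M μ v) (hu : IsLeftEigenvector M μ u) :
    eigenPairing M μ v u ≠ 0 ∧
      (M μ).adjugate = (deriv (fun z => (M z).det) μ * (eigenPairing M μ v u)⁻¹) •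
        Matrix.vecMulVec v (star u) := by
  set d := deriv (fun z => (M z).det) μ with hdd
  obtain ⟨c, hc⟩ := Matrix.adjugate_eq_smul_vecMulVec hv.1 (star_ne_zero.2 hu.1) hv.2 hu.2
  obtain ⟨j, hj⟩ : ∃ j, star u j ≠ 0 := Function.ne_iff.1 (star_ne_zero.2 hu.1)
  have hdet : HasDerivAt (fun z => (M z).det) d μ :=
    (AnalyticAt.matrix_det h).differentiableAt.hasDerivAt
  have hMd : ∀ i k, HasDerivAt (fun z => M z i k) (matrixDeriv M μ i k) μ :=
    fun i k => (h i k).differentiableAt.hasDerivAt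
  have hAd : ∀ i k, HasDerivAt (fun z => (M z).adjugate i k)
      (deriv (fun z => (M z).adjugate i k) μ) μ :=
    fun i k => (AnalyticAt.matrix_adjugate h i k).differentiableAt.hasDerivAt
  -- Entry `j` of `uᴴ M adj M = det M uᴴ` is differentiated in two ways; `uᴴ M(μ) = 0` removes the
  -- unknown derivative of the adjugate.
  have h1 : HasDerivAt (fun z => ∑ k, (∑ i, star u i * M z i k) * (M z).adjugate k j)
      (∑ k, ((∑ i, star u i * matrixDeriv M μ i k) * (M μ).adjugate k j +
        (∑ i, star u i * M μ i k) * deriv (fun z => (M z).adjugate k j) μ)) μ :=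
    HasDerivAt.fun_sum fun k _ =>
      (HasDerivAt.fun_sum fun i _ => (hMd i k).const_mul _).mul (hAd k j)
  have h2 : (fun z => ∑ k, (∑ i, star u i * M z i k) * (M z).adjugate k j) =
      fun z => (M z).det * star u j := by
    ext z
    have := congrFun (congrArg (Matrix.vecMul (star u)) (Matrix.mul_adjugate (M z))) j
    rw [← Matrix.vecMul_vecMul, Matrix.vecMul_smul, Matrix.vecMul_one] at this
    simpa [Matrix.vecMul, dotProduct] using this
  have h3 : ∀ k, ∑ i, star u i * M μ i k = 0 := fun k => congrFun hu.2 k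
  rw [h2] at h1
  have h4 := h1.unique (hdet.mul_const _)
  simp only [h3, zero_mul, add_zero, hc, Matrix.smul_apply, Matrix.vecMulVec_apply,
    smul_eq_mul] at h4
  have h5 : eigenPairing M μ v u = ∑ k, (∑ i, star u i * matrixDeriv M μ i k) * v k := by
    rw [eigenPairing, Matrix.dotProduct_mulVec]
    simp [Matrix.vecMul, dotProduct]
  have h6 : c * eigenPairing M μ v u = d := by
    apply mul_right_cancel₀ hj
    rw [← h4, h5, Finset.mul_sum, Finset.sum_mul]
    exact Finset.sum_congr rfl fun k _ => by ring
  have h7 : eigenPairing M μ v u ≠ 0 := fun h0 => hd (by rw [← h6, h0, mul_zero])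
  refine ⟨h7, ?_⟩
  rw [hc, ← h6, mul_inv_cancel_right₀ h7]

theorem IsSimpleEigenvalue.exists_det_eq (h : ∀ i j, AnalyticAt ℂ (fun z => M z i j) μ)
    (hs : IsSimpleEigenvalue M μ) : ∃ g : ℂ → ℂ, AnalyticAt ℂ g μ ∧ g μ ≠ 0 ∧
      g μ = deriv (fun z => (M z).det) μ ∧ ∀ᶠ z in 𝓝 μ, (M z).det = (z - μ) * g z := by
  obtain ⟨g, hg, hg0, hev⟩ :=
    ((AnalyticAt.matrix_det h).analyticOrderAt_eq_natCast (n := 1)).1 (by simpa using hs.2)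
  simp only [pow_one, smul_eq_mul] at hev
  refine ⟨g, hg, hg0, ?_, hev⟩
  have h1 : HasDerivAt (fun z => (z - μ) * g z) (1 * g μ + (μ - μ) * deriv g μ) μ :=
    ((hasDerivAt_id μ).sub_const μ).mul hg.differentiableAt.hasDerivAt
  rw [Filter.EventuallyEq.deriv_eq hev, h1.deriv]
  simp

theorem eigenPairing_ne_zero (h : ∀ i j, AnalyticAt ℂ (fun z => M z i j) μ)
    (hs : IsSimpleEigenvalue M μ) {v u : Fin n → ℂ}
    (hv : IsRightEigenvector M μ v) (hu : IsLeftEigenvector M μ u) :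
    eigenPairing M μ v u ≠ 0 := by
  obtain ⟨g, -, hg0, hgd, -⟩ := hs.exists_det_eq h
  exact (exists_adjugate_eq_smul_of_simple h (hgd ▸ hg0) hv hu).1

theorem IsSimpleEigenvalue.eventually_not_isNEPEigenvalue
    (h : ∀ i j, AnalyticAt ℂ (fun z => M z i j) μ) (hs : IsSimpleEigenvalue M μ) :
    ∀ᶠ z in 𝓝[≠] μ, ¬ IsNEPEigenvalue M z := by
  obtain ⟨g, hg, hg0, -, hev⟩ := hs.exists_det_eq h
  filter_upwards [nhdsWithin_le_nhds hev, nhdsWithin_le_nhds (hg.continuousAt.eventually_ne hg0),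
    self_mem_nhdsWithin] with z hz hgz hzμ
  rw [isNEPEigenvalue_iff, hz]
  exact mul_ne_zero (sub_ne_zero.2 hzμ) hgz

theorem exists_analyticAt_inv_sub_principalPart (h : ∀ i j, AnalyticAt ℂ (fun z => M z i j) μ)
    (hs : IsSimpleEigenvalue M μ) {v u : Fin n → ℂ}
    (hv : IsRightEigenvector M μ v) (hu : IsLeftEigenvector M μ u) (i j : Fin n) :
    ∃ f : ℂ → ℂ, AnalyticAt ℂ f μ ∧ ∀ᶠ z in 𝓝[≠] μ, (M z)⁻¹ i j -
      ((z - μ)⁻¹ * (eigenPairing M μ v u)⁻¹) * Matrix.vecMulVec v (star u) i j = f z := by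
  obtain ⟨g, hg, hg0, hgd, hev⟩ := hs.exists_det_eq h
  have hA := (exists_adjugate_eq_smul_of_simple h (hgd ▸ hg0) hv hu).2
  have hq : AnalyticAt ℂ (fun z => (M z).adjugate i j / g z) μ :=
    (AnalyticAt.matrix_adjugate h i j).div hg hg0
  obtain ⟨p, hp⟩ := hq
  -- The witness is the difference quotient of `adj M / g` at `μ`: the principal part is the value
  -- of `adj M / g` at `μ`, divided by `z - μ`.
  refine ⟨_, ⟨_, hp.has_fpower_series_dslope_fslope⟩, ?_⟩
  filter_upwards [nhdsWithin_le_nhds hev, self_mem_nhdsWithin] with z hz hzμ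
  have hne : z - μ ≠ 0 := sub_ne_zero.2 hzμ
  rw [dslope_of_ne _ hzμ, slope_def_field, hA, Matrix.inv_def, hz, ← hgd, Ring.inverse_eq_inv']
  simp only [Matrix.smul_apply, smul_eq_mul, mul_inv]
  field_simp

end

/-! ### Contour integrals, Cauchy transforms and the interior of the curve. -/

namespace SimpleClosedCurve

variable (Γ : SimpleClosedCurve)

theorem continuousOn_uIcc : ContinuousOn Γ.toFun (uIcc Γ.a Γ.b) := by
  rw [uIcc_of_le Γ.a_lt_b.le]
  exact Γ.continuousOn

theorem isCompact_carrier : IsCompact Γ.carrier :=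
  isCompact_Icc.image_of_continuousOn Γ.continuousOn

theorem mem_carrier {t : ℝ} (ht : t ∈ uIcc Γ.a Γ.b) : Γ.toFun t ∈ Γ.carrier := by
  rw [uIcc_of_le Γ.a_lt_b.le] at ht
  exact mem_image_of_mem _ ht

theorem isOpen_compl_carrier : IsOpen Γ.carrierᶜ := Γ.isCompact_carrier.isClosed.isOpen_compl

theorem intervalIntegrable_deriv :
    IntervalIntegrable (deriv Γ.toFun) MeasureTheory.volume Γ.a Γ.b := by
  obtain ⟨m, t, h0, hm, h⟩ := Γ.piecewise_smooth
  rw [← h0, ← hm]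
  refine IntervalIntegrable.trans_iterate fun k hk => ?_
  obtain ⟨hlt, hC⟩ := h k hk
  have hcont : ContinuousOn (derivWithin Γ.toFun (Icc (t k) (t (k + 1))))
      (Icc (t k) (t (k + 1))) :=
    hC.continuousOn_derivWithin (uniqueDiffOn_Icc hlt) le_rfl
  refine (ContinuousOn.intervalIntegrable_of_Icc hlt.le hcont).congr_uIoo fun x hx => ?_
  rw [uIoo_of_le hlt.le] at hx
  exact derivWithin_of_mem_nhds (Icc_mem_nhds hx.1 hx.2)

theorem exists_countable_hasDerivAt : ∃ s : Set ℝ, s.Countable ∧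
    ∀ x ∈ Ioo Γ.a Γ.b \ s, HasDerivAt Γ.toFun (deriv Γ.toFun x) x := by
  obtain ⟨m, t, h0, hm, h⟩ := Γ.piecewise_smooth
  -- Values `t k` with `k > m` are irrelevant but harmless: only countability is needed.
  refine ⟨range t, countable_range t, fun x ⟨hx, hxt⟩ => ?_⟩
  have hex : ∃ k, x < t k := ⟨m, hm ▸ hx.2⟩
  classical
  obtain ⟨k, hk⟩ : ∃ k, Nat.find hex = k + 1 := by
    refine Nat.exists_eq_succ_of_ne_zero fun h' => ?_
    have := Nat.find_spec hex
    rw [h', h0] at this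
    exact lt_asymm this hx.1
  have hlt : x < t (k + 1) := hk ▸ Nat.find_spec hex
  have hge : t k < x := by
    refine lt_of_le_of_ne (not_lt.1 (Nat.find_min hex (by omega))) fun h' => hxt ⟨k, h'⟩
  have hkm : k < m := by
    have := Nat.find_min' hex (hm ▸ hx.2 : x < t m)
    omega
  exact (((h k hkm).2.differentiableOn one_ne_zero).differentiableAt
    (Icc_mem_nhds hge hlt)).hasDerivAt

variable {Γ}

theorem contourIntegrable_of_continuousOn {f : ℂ → ℂ} (hf : ContinuousOn f Γ.carrier) :
    Γ.ContourIntegrable f :=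
  Γ.intervalIntegrable_deriv.continuousOn_mul
    (hf.comp Γ.continuousOn_uIcc fun _ ht => Γ.mem_carrier ht)

theorem contourIntegral_congr {f g : ℂ → ℂ} (h : EqOn f g Γ.carrier) :
    Γ.contourIntegral f = Γ.contourIntegral g :=
  intervalIntegral.integral_congr fun t ht => by
    simp only [h (Γ.mem_carrier ht)]

theorem contourIntegral_add {f g : ℂ → ℂ} (hf : Γ.ContourIntegrable f)
    (hg : Γ.ContourIntegrable g) :
    Γ.contourIntegral (fun w => f w + g w) = Γ.contourIntegral f + Γ.contourIntegral g := by
  simp only [contourIntegral, add_mul]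
  exact intervalIntegral.integral_add hf hg

theorem contourIntegral_sub {f g : ℂ → ℂ} (hf : Γ.ContourIntegrable f)
    (hg : Γ.ContourIntegrable g) :
    Γ.contourIntegral (fun w => f w - g w) = Γ.contourIntegral f - Γ.contourIntegral g := by
  simp only [contourIntegral, sub_mul]
  exact intervalIntegral.integral_sub hf hg

theorem contourIntegral_const_mul (c : ℂ) (f : ℂ → ℂ) :
    Γ.contourIntegral (fun w => c * f w) = c * Γ.contourIntegral f := by
  simp only [contourIntegral, mul_assoc]
  exact intervalIntegral.integral_const_mul _ _

theorem contourIntegral_finset_sum {ι : Type*} (s : Finset ι) {f : ι → ℂ → ℂ}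
    (hf : ∀ i ∈ s, Γ.ContourIntegrable (f i)) :
    Γ.contourIntegral (fun w => ∑ i ∈ s, f i w) = ∑ i ∈ s, Γ.contourIntegral (f i) := by
  simp only [contourIntegral, Finset.sum_mul]
  exact intervalIntegral.integral_finsetSum hf

theorem contourIntegral_eq_zero_of_hasDerivAt {F f : ℂ → ℂ} (hf : ContinuousOn f Γ.carrier)
    (hF : ∀ w ∈ Γ.carrier, HasDerivAt F (f w) w) : Γ.contourIntegral f = 0 := by
  obtain ⟨s, hs, hd⟩ := Γ.exists_countable_hasDerivAt
  have hFc : ContinuousOn F Γ.carrier := fun w hw => (hF w hw).continuousAt.continuousWithinAt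
  have := MeasureTheory.integral_eq_of_hasDerivAt_off_countable (fun t => F (Γ.toFun t))
    (fun t => f (Γ.toFun t) * deriv Γ.toFun t) (a := Γ.a) (b := Γ.b) hs
    (hFc.comp Γ.continuousOn_uIcc fun _ ht => Γ.mem_carrier ht)
    (by
      rw [min_eq_left Γ.a_lt_b.le, max_eq_right Γ.a_lt_b.le]
      intro x hx
      exact (hF _ ⟨x, Ioo_subset_Icc_self hx.1, rfl⟩).comp x (hd x hx))
    (contourIntegrable_of_continuousOn hf)
  rw [contourIntegral, this, Γ.closed, sub_self]

/-- A contour integral depending holomorphically on a parameter is holomorphic. -/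
theorem hasDerivAt_contourIntegral {V : Set ℂ} (hV : IsOpen V) {G : ℂ → ℂ → ℂ}
    (hd : ∀ w ∈ Γ.carrier, DifferentiableOn ℂ (fun z => G z w) V)
    (hc : ContinuousOn (Function.uncurry G) (V ×ˢ Γ.carrier)) {z₀ : ℂ} (hz₀ : z₀ ∈ V) :
    HasDerivAt (fun z => Γ.contourIntegral (G z))
      (Γ.contourIntegral fun w => deriv (fun z => G z w) z₀) z₀ := by
  have hcz : ∀ z ∈ V, ContinuousOn (G z) Γ.carrier := fun z hz =>
    hc.comp (f := fun w => (z, w)) (by fun_prop) fun w hw => ⟨hz, hw⟩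
  have hint : ∀ z ∈ V, Γ.ContourIntegrable (G z) := fun z hz =>
    contourIntegrable_of_continuousOn (hcz z hz)
  obtain ⟨r, hr, hrV⟩ := Metric.nhds_basis_closedBall.mem_iff.1 (hV.mem_nhds hz₀)
  obtain ⟨C, hC⟩ := ((isCompact_closedBall z₀ r).prod Γ.isCompact_carrier).exists_bound_of_continuousOn
    (hc.mono (prod_mono hrV Subset.rfl))
  have hr2 : 0 < r / 2 := by positivity
  have hsub : ∀ z ∈ Metric.ball z₀ (r / 2), Metric.closedBall z (r / 2) ⊆ Metric.closedBall z₀ r :=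
    fun z hz => Metric.closedBall_subset_closedBall' (by
      have := Metric.mem_ball.1 hz
      linarith)
  -- Cauchy's estimate on circles of radius `r / 2`, which stay in the ball where `G` is bounded by
  -- `C`.
  have hbound : ∀ w ∈ Γ.carrier, ∀ z ∈ Metric.ball z₀ (r / 2),
      ‖deriv (fun z => G z w) z‖ ≤ C / (r / 2) := by
    intro w hw z hz
    refine Complex.norm_deriv_le_of_forall_mem_sphere_norm_le hr2 ?_ fun y hy =>
      hC (y, w) ⟨hsub z hz (Metric.sphere_subset_closedBall hy), hw⟩
    apply DifferentiableOn.diffContOnCl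
    rw [closure_ball _ hr2.ne']
    exact (hd w hw).mono ((hsub z hz).trans hrV)
  have hVd : ∀ w ∈ Γ.carrier, ∀ z ∈ V, HasDerivAt (fun z => G z w) (deriv (fun z => G z w) z) z :=
    fun w hw z hz => ((hd w hw).differentiableAt (hV.mem_nhds hz)).hasDerivAt
  have hball : Metric.ball z₀ (r / 2) ⊆ V :=
    (Metric.ball_subset_ball (by linarith)).trans (Metric.ball_subset_closedBall.trans hrV)
  -- The derivative is a pointwise limit of difference quotients along a sequence tending to `z₀`;
  -- the shift by `m₀` keeps the whole sequence in `V`.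
  have hmeas : MeasureTheory.AEStronglyMeasurable
      (fun t => deriv (fun z => G z (Γ.toFun t)) z₀ * deriv Γ.toFun t)
      (MeasureTheory.volume.restrict (uIoc Γ.a Γ.b)) := by
    have hseq : Tendsto (fun m : ℕ => z₀ + ((r / 2 * (1 / ((m : ℝ) + 1)) : ℝ) : ℂ)) atTop
        (𝓝[≠] z₀) := by
      rw [tendsto_nhdsWithin_iff]
      constructor
      · have h1 : Tendsto (fun m : ℕ => r / 2 * (1 / ((m : ℝ) + 1))) atTop (𝓝 (r / 2 * 0)) :=
          tendsto_one_div_add_atTop_nhds_zero_nat.const_mul _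
        have h2 := (Complex.continuous_ofReal.tendsto _).comp h1
        simpa using h2.const_add z₀
      · refine Eventually.of_forall fun m => ?_
        have : 0 < r / 2 * (1 / ((m : ℝ) + 1)) := by positivity
        rw [mem_compl_singleton_iff, Ne, add_eq_left, Complex.ofReal_eq_zero]
        exact this.ne'
    have hseqV : ∀ᶠ m : ℕ in atTop, z₀ + ((r / 2 * (1 / ((m : ℝ) + 1)) : ℝ) : ℂ) ∈ V :=
      (tendsto_nhdsWithin_iff.1 hseq).1.eventually (hV.mem_nhds hz₀)
    obtain ⟨m₀, hm₀⟩ := eventually_atTop.1 hseqV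
    refine aestronglyMeasurable_of_tendsto_ae (u := atTop)
      (f := fun (m : ℕ) t => slope (fun z => G z (Γ.toFun t)) z₀
        (z₀ + ((r / 2 * (1 / (((m + m₀ : ℕ) : ℝ) + 1)) : ℝ) : ℂ)) * deriv Γ.toFun t) ?_ ?_
    · intro m
      have h1 := (intervalIntegrable_iff.1 (hint _ (hm₀ (m + m₀) (by omega)))).aestronglyMeasurable
      have h0 := (intervalIntegrable_iff.1 (hint _ hz₀)).aestronglyMeasurable
      refine ((h1.sub h0).const_mul ((z₀ + ((r / 2 * (1 / (((m + m₀ : ℕ) : ℝ) + 1)) : ℝ) : ℂ)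
        - z₀)⁻¹)).congr (Eventually.of_forall fun t => ?_)
      simp only [slope_def_field, Pi.sub_apply]
      ring
    · refine (MeasureTheory.ae_restrict_mem measurableSet_uIoc).mono fun t ht => ?_
      have hw := Γ.mem_carrier (uIoc_subset_uIcc ht)
      have := (hasDerivAt_iff_tendsto_slope.1 (hVd _ hw _ hz₀)).comp
        (hseq.comp (tendsto_add_atTop_nat m₀))
      exact this.mul_const _
  have key := intervalIntegral.hasDerivAt_integral_of_dominated_loc_of_deriv_le
    (μ := MeasureTheory.volume) (a := Γ.a) (b := Γ.b)
    (F := fun z t => G z (Γ.toFun t) * deriv Γ.toFun t)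
    (F' := fun z t => deriv (fun z => G z (Γ.toFun t)) z * deriv Γ.toFun t)
    (x₀ := z₀) (s := Metric.ball z₀ (r / 2)) (bound := fun t => C / (r / 2) * ‖deriv Γ.toFun t‖)
    (Metric.ball_mem_nhds _ hr2)
    (Eventually.mono (hV.mem_nhds hz₀) fun z hz =>
      (intervalIntegrable_iff.1 (hint z hz)).aestronglyMeasurable)
    (hint z₀ hz₀) hmeas
    (Eventually.of_forall fun t ht z hz => by
      rw [norm_mul]
      exact mul_le_mul_of_nonneg_right (hbound _ (Γ.mem_carrier (uIoc_subset_uIcc ht)) z hz)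
        (norm_nonneg _))
    (Γ.intervalIntegrable_deriv.norm.const_mul _)
    (Eventually.of_forall fun t ht z hz =>
      (hVd _ (Γ.mem_carrier (uIoc_subset_uIcc ht)) z (hball hz)).mul_const _)
  exact key.2

theorem sub_ne_zero_of_mem {w z : ℂ} (hw : w ∈ Γ.carrier) (hz : z ∈ Γ.carrierᶜ) : w - z ≠ 0 :=
  fun h => hz (sub_eq_zero.1 h ▸ hw)

theorem continuousOn_cauchyKernel {φ : ℂ → ℂ} (hφ : ContinuousOn φ Γ.carrier) :
    ContinuousOn (Function.uncurry fun z w => φ w / (w - z)) (Γ.carrierᶜ ×ˢ Γ.carrier) := by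
  have h1 : ContinuousOn (fun p : ℂ × ℂ => φ p.2) (Γ.carrierᶜ ×ˢ Γ.carrier) :=
    hφ.comp (by fun_prop) fun p hp => hp.2
  exact h1.div (by fun_prop) fun p hp => sub_ne_zero_of_mem hp.2 hp.1

theorem continuousOn_div_sub {φ : ℂ → ℂ} (hφ : ContinuousOn φ Γ.carrier) {z : ℂ}
    (hz : z ∈ Γ.carrierᶜ) : ContinuousOn (fun w => φ w / (w - z)) Γ.carrier :=
  hφ.div (by fun_prop) fun _ hw => sub_ne_zero_of_mem hw hz

theorem hasDerivAt_cauchyTransform {φ : ℂ → ℂ} (hφ : ContinuousOn φ Γ.carrier) {z : ℂ}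
    (hz : z ∈ Γ.carrierᶜ) : HasDerivAt (fun z => Γ.contourIntegral fun w => φ w / (w - z))
      (Γ.contourIntegral fun w => φ w / (w - z) ^ 2) z := by
  have hd : ∀ w ∈ Γ.carrier, ∀ z ∈ Γ.carrierᶜ,
      HasDerivAt (fun z => φ w / (w - z)) (φ w / (w - z) ^ 2) z := by
    intro w hw z hz
    have := (((hasDerivAt_id z).const_sub w).inv (sub_ne_zero_of_mem hw hz)).const_mul (φ w)
    convert! this using 1
    simp [div_eq_mul_inv]
  have := hasDerivAt_contourIntegral Γ.isOpen_compl_carrier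
    (fun w hw z hz => (hd w hw z hz).differentiableAt.differentiableWithinAt)
    (continuousOn_cauchyKernel hφ) hz
  rwa [contourIntegral_congr fun w hw => (hd w hw z hz).deriv] at this

theorem tendsto_cauchyTransform {φ : ℂ → ℂ} (hφ : ContinuousOn φ Γ.carrier) :
    Tendsto (fun z => Γ.contourIntegral fun w => φ w / (w - z)) (cocompact ℂ) (𝓝 0) := by
  obtain ⟨C, hC⟩ := Γ.isCompact_carrier.exists_bound_of_continuousOn hφ
  obtain ⟨B, hB⟩ := Γ.isCompact_carrier.exists_bound_of_continuousOn continuousOn_id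
  set L := |∫ t in Γ.a..Γ.b, ‖deriv Γ.toFun t‖| with hL
  have hC0 : 0 ≤ C := (norm_nonneg _).trans (hC _ (Γ.mem_carrier left_mem_uIcc))
  have hlim : Tendsto (fun z : ℂ => C / (‖z‖ - B) * L) (cocompact ℂ) (𝓝 0) := by
    have h1 : Tendsto (fun z : ℂ => ‖z‖ - B) (cocompact ℂ) atTop :=
      tendsto_atTop_add_const_right _ _ (tendsto_norm_cocompact_atTop (E := ℂ))
    simpa using (h1.const_div_atTop C).mul_const L
  refine squeeze_zero_norm' ?_ hlim
  filter_upwards [(tendsto_norm_cocompact_atTop (E := ℂ)).eventually_gt_atTop B] with z hz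
  have hle : ∀ t ∈ uIoc Γ.a Γ.b, ‖φ (Γ.toFun t) / (Γ.toFun t - z) * deriv Γ.toFun t‖ ≤
      C / (‖z‖ - B) * ‖deriv Γ.toFun t‖ := by
    intro t ht
    have hw := Γ.mem_carrier (uIoc_subset_uIcc ht)
    rw [norm_mul, norm_div]
    refine mul_le_mul_of_nonneg_right ?_ (norm_nonneg _)
    refine div_le_div₀ hC0 (hC _ hw) (sub_pos.2 hz) ?_
    have h1 : ‖Γ.toFun t‖ ≤ B := hB _ hw
    have h2 := norm_sub_norm_le z (Γ.toFun t)
    rw [norm_sub_rev] at h2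
    linarith
  rw [contourIntegral]
  refine (intervalIntegral.norm_integral_le_abs_of_norm_le
    ((MeasureTheory.ae_restrict_mem measurableSet_uIoc).mono hle)
    (Γ.intervalIntegrable_deriv.norm.const_mul _)).trans_eq ?_
  rw [intervalIntegral.integral_const_mul, abs_mul, abs_of_nonneg]
  exact div_nonneg hC0 (sub_pos.2 hz).le

theorem contourIntegral_div_sub_sq {z : ℂ} (hz : z ∈ Γ.carrierᶜ) :
    Γ.contourIntegral (fun w => 1 / (w - z) ^ 2) = 0 := by
  refine contourIntegral_eq_zero_of_hasDerivAt (F := fun w => -(w - z)⁻¹) ?_ fun w hw => ?_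
  · exact continuousOn_const.div (by fun_prop) fun w hw => pow_ne_zero _ (sub_ne_zero_of_mem hw hz)
  · have := (((hasDerivAt_id w).sub_const z).inv (sub_ne_zero_of_mem hw hz)).neg
    convert! this using 1
    simp [neg_div]

/-- The winding number vanishes in the exterior of the curve. -/
theorem contourIntegral_div_sub_eq_zero {z : ℂ} (hz : z ∈ Γ.carrierᶜ) (hzi : z ∉ Γ.interior) :
    Γ.contourIntegral (fun w => 1 / (w - z)) = 0 := by
  set S := connectedComponentIn Γ.carrierᶜ z with hS
  have hSub : S ⊆ Γ.carrierᶜ := connectedComponentIn_subset _ _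
  have hSz : z ∈ S := mem_connectedComponentIn hz
  have hunb : ¬ Bornology.IsBounded S := fun h => hzi ⟨hz, h⟩
  set W : ℂ → ℂ := fun z => Γ.contourIntegral fun w => 1 / (w - z) with hW
  -- `W` is locally constant because `1 / (w - y) ^ 2` has a primitive. Its constant value on the
  -- unbounded component must be its limit `0` at infinity.
  have hder : ∀ y ∈ S, HasDerivAt W 0 y := fun y hy => by
    have := hasDerivAt_cauchyTransform (φ := fun _ => 1) continuousOn_const (hSub hy)
    rwa [contourIntegral_div_sub_sq (hSub hy)] at this
  have hconst : ∀ y ∈ S, W y = W z := fun y hy =>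
    Γ.isOpen_compl_carrier.connectedComponentIn.is_const_of_deriv_eq_zero
      isPreconnected_connectedComponentIn
      (fun x hx => (hder x hx).differentiableAt.differentiableWithinAt)
      (fun x hx => (hder x hx).deriv) hy hSz
  by_contra hne
  have hlim : Tendsto W (cocompact ℂ) (𝓝 0) :=
    tendsto_cauchyTransform (φ := fun _ => 1) continuousOn_const
  have hev : ∀ᶠ y in cocompact ℂ, W y ≠ W z := hlim.eventually_ne (Ne.symm hne)
  apply hunb
  rw [Metric.cobounded_eq_cocompact.symm] at hev
  rw [← Bornology.isCobounded_compl_iff]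
  exact mem_of_superset hev fun y hy hyS => hy (hconst y hyS)

theorem isCompact_interior_union_carrier : IsCompact (Γ.interior ∪ Γ.carrier) := by
  have hext : (Γ.interior ∪ Γ.carrier)ᶜ =
      {z | z ∈ Γ.carrierᶜ ∧ ¬ Bornology.IsBounded (connectedComponentIn Γ.carrierᶜ z)} := by
    ext z
    simp only [interior, mem_compl_iff, mem_union, mem_ofPred_eq]
    tauto
  refine Metric.isCompact_of_isClosed_isBounded ?_ ?_
  · rw [← isOpen_compl_iff, hext, isOpen_iff_mem_nhds]
    rintro z ⟨hz, hb⟩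
    refine mem_of_superset (Γ.isOpen_compl_carrier.connectedComponentIn.mem_nhds
      (mem_connectedComponentIn hz)) fun y hy => ⟨connectedComponentIn_subset _ _ hy, ?_⟩
    rwa [← connectedComponentIn_eq hy]
  · obtain ⟨B, hB⟩ := Γ.isCompact_carrier.isBounded.subset_closedBall (0 : ℂ)
    refine (Metric.isBounded_closedBall (x := (0 : ℂ)) (r := B)).subset ?_
    refine union_subset (fun z hz => ?_) hB
    by_contra hzB
    rw [mem_closedBall_zero_iff, not_le] at hzB
    have hz0 : 0 < ‖z‖ := by
      have := mem_closedBall_zero_iff.1 (hB (Γ.mem_carrier left_mem_uIcc))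
      exact ((norm_nonneg _).trans this).trans_lt hzB
    -- Outside a disc containing the curve, the radial ray from `z` to infinity avoids the curve, so
    -- the component of `z` is unbounded.
    have hsub : (fun s : ℝ => s • z) '' Ici 1 ⊆ connectedComponentIn Γ.carrierᶜ z := by
      refine (isPreconnected_Ici.image _ (by fun_prop)).subset_connectedComponentIn
        ⟨1, mem_Ici.2 le_rfl, one_smul _ _⟩ ?_
      rintro _ ⟨s, hs, rfl⟩ hsc
      have h1 := mem_closedBall_zero_iff.1 (hB hsc)
      rw [norm_smul, Real.norm_of_nonneg (zero_le_one.trans hs)] at h1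
      have h2 := mul_le_mul_of_nonneg_right (mem_Ici.1 hs) hz0.le
      linarith
    obtain ⟨C, hC⟩ := (hz.2.subset hsub).exists_norm_le
    have h1 := hC _ ⟨1 + |C| / ‖z‖, mem_Ici.2 (le_add_of_nonneg_right (by positivity)), rfl⟩
    rw [norm_smul, Real.norm_of_nonneg (by positivity), add_mul, div_mul_cancel₀ _ hz0.ne'] at h1
    have := le_abs_self C
    linarith

theorem isOpen_interior : IsOpen Γ.interior := by
  rw [isOpen_iff_mem_nhds]
  rintro z ⟨hz, hb⟩
  refine mem_of_superset (Γ.isOpen_compl_carrier.connectedComponentIn.mem_nhds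
    (mem_connectedComponentIn hz)) fun y hy => ⟨connectedComponentIn_subset _ _ hy, ?_⟩
  rwa [← connectedComponentIn_eq hy]

end SimpleClosedCurve

/-! ### Cauchy's integral formula. -/

theorem dslope_symm (f : ℂ → ℂ) (z w : ℂ) : dslope f z w = dslope f w z := by
  rcases eq_or_ne w z with rfl | h
  · rfl
  · rw [dslope_of_ne _ h, dslope_of_ne _ h.symm, slope_comm]

/-- On the diagonal, strict differentiability controls quotients at two moving points, and
continuity of `deriv f` controls the diagonal values. -/
theorem AnalyticOnNhd.continuousOn_uncurry_dslope {f : ℂ → ℂ} {U : Set ℂ}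
    (hf : AnalyticOnNhd ℂ f U) : ContinuousOn (Function.uncurry (dslope f)) (U ×ˢ U) := by
  rintro ⟨z, w⟩ ⟨hz, hw⟩
  refine ContinuousAt.continuousWithinAt ?_
  rcases eq_or_ne w z with rfl | h
  · have hs := (hf w hw).hasStrictDerivAt
    have hder : Tendsto (fun p : ℂ × ℂ => deriv f p.1) (𝓝 (w, w)) (𝓝 (deriv f w)) :=
      (hf w hw).deriv.continuousAt.tendsto.comp continuousAt_fst
    rw [ContinuousAt, Metric.tendsto_nhds]
    intro ε hε
    filter_upwards [hs.isLittleO.def (half_pos hε), Metric.tendsto_nhds.1 hder ε hε] with p h1 h2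
    simp only [Function.uncurry, dslope_same]
    rcases eq_or_ne p.2 p.1 with hp | hp
    · rw [hp, dslope_same]
      exact h2
    · have hpos : 0 < ‖p.1 - p.2‖ := norm_pos_iff.2 (sub_ne_zero.2 hp.symm)
      rw [dslope_of_ne _ hp, slope_comm, slope_def_field, dist_eq_norm]
      have h3 : (f p.1 - f p.2) / (p.1 - p.2) - deriv f w =
          (f p.1 - f p.2 - (p.1 - p.2) * deriv f w) / (p.1 - p.2) := by
        have := sub_ne_zero.2 hp.symm
        field_simp
      rw [h3, norm_div, div_lt_iff₀ hpos]
      simp only [smul_eq_mul, ContinuousLinearMap.toSpanSingleton_apply] at h1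
      nlinarith
  · have hev : ∀ᶠ p : ℂ × ℂ in 𝓝 (z, w), p.2 ≠ p.1 :=
      (continuous_snd.continuousAt.sub continuous_fst.continuousAt).eventually_ne
        (sub_ne_zero.2 h) |>.mono fun p hp => sub_ne_zero.1 hp
    have h1 : ContinuousAt (fun p : ℂ × ℂ => f p.1) (z, w) :=
      (hf z hz).continuousAt.comp (x := (z, w)) continuousAt_fst
    have h2 : ContinuousAt (fun p : ℂ × ℂ => f p.2) (z, w) :=
      (hf w hw).continuousAt.comp (x := (z, w)) continuousAt_snd
    have h3 : ContinuousAt (fun p : ℂ × ℂ => (f p.2 - f p.1) / (p.2 - p.1)) (z, w) :=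
      (h2.sub h1).div (continuousAt_snd.sub continuousAt_fst) (sub_ne_zero.2 h)
    refine h3.congr (hev.mono fun p hp => ?_)
    simp only [Function.uncurry]
    rw [dslope_of_ne _ hp, slope_def_field]

namespace SimpleClosedCurve

variable {Γ : SimpleClosedCurve}

/-- Cauchy's integral formula, by Dixon's argument. -/
theorem contourIntegral_div_sub_eq {U : Set ℂ} (hU : IsOpen U)
    (hΓU : Γ.interior ∪ Γ.carrier ⊆ U) {f : ℂ → ℂ} (hf : AnalyticOnNhd ℂ f U) {z : ℂ}
    (hz : z ∈ Γ.interior) :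
    Γ.contourIntegral (fun w => f w / (w - z)) =
      f z * Γ.contourIntegral (fun w => 1 / (w - z)) := by
  have hcar : Γ.carrier ⊆ U := subset_union_right.trans hΓU
  have hfc : ContinuousOn f Γ.carrier := hf.continuousOn.mono hcar
  have hds : ContinuousOn (Function.uncurry (dslope f)) (U ×ˢ Γ.carrier) :=
    hf.continuousOn_uncurry_dslope.mono (prod_mono Subset.rfl hcar)
  have hsplit : ∀ y ∈ Γ.carrierᶜ, Γ.contourIntegral (dslope f y) =
      Γ.contourIntegral (fun w => f w / (w - y)) -
        f y * Γ.contourIntegral (fun w => 1 / (w - y)) := by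
    intro y hy
    have hc : ContinuousOn (fun w => f y * (1 / (w - y))) Γ.carrier :=
      continuousOn_const.mul (continuousOn_div_sub continuousOn_const hy)
    rw [← contourIntegral_const_mul, ← contourIntegral_sub
      (contourIntegrable_of_continuousOn (continuousOn_div_sub hfc hy))
      (contourIntegrable_of_continuousOn hc)]
    refine contourIntegral_congr fun w hw => ?_
    rw [dslope_of_ne _ (sub_ne_zero.1 (sub_ne_zero_of_mem hw hy)), slope_def_field]
    ring
  classical
  -- Both formulas agree on `U` outside the curve and its interior, where the winding number is
  -- zero. Hence `h` is entire; it vanishes at infinity, so it is zero by Liouville.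
  set h : ℂ → ℂ := fun y => if y ∈ U then Γ.contourIntegral (dslope f y) else
    Γ.contourIntegral (fun w => f w / (w - y)) with hh
  have hout : ∀ y ∈ (Γ.interior ∪ Γ.carrier)ᶜ,
      h y = Γ.contourIntegral (fun w => f w / (w - y)) := by
    intro y hy
    rw [mem_compl_iff, mem_union, not_or] at hy
    simp only [hh]
    split_ifs
    · rw [hsplit y hy.2, contourIntegral_div_sub_eq_zero hy.2 hy.1, mul_zero, sub_zero]
    · rfl
  have hopen : IsOpen (Γ.interior ∪ Γ.carrier)ᶜ :=
    isCompact_interior_union_carrier.isClosed.isOpen_compl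
  have hdiff : Differentiable ℂ h := by
    intro y
    by_cases hy : y ∈ U
    · have hd := hasDerivAt_contourIntegral hU (G := dslope f) (fun w hw => by
        -- Symmetry makes `z` the moving point of the slope based at `w`, so the singularity at `z =
        -- w` is removable.
        simp_rw [fun z => dslope_symm f z w]
        exact (Complex.differentiableOn_dslope (hU.mem_nhds (hcar hw))).2 hf.differentiableOn)
        hds hy
      refine hd.differentiableAt.congr_of_eventuallyEq ?_
      filter_upwards [hU.mem_nhds hy] with x hx
      simp only [hh, if_pos hx]
    · have hy' : y ∈ (Γ.interior ∪ Γ.carrier)ᶜ := fun h' => hy (hΓU h')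
      refine (hasDerivAt_cauchyTransform hfc
        fun h' => hy' (Or.inr h')).differentiableAt.congr_of_eventuallyEq ?_
      filter_upwards [hopen.mem_nhds hy'] with x hx
      exact hout x hx
  have hlim : Tendsto h (cocompact ℂ) (𝓝 0) := by
    refine (tendsto_cauchyTransform hfc).congr' ?_
    filter_upwards [isCompact_interior_union_carrier.compl_mem_cocompact] with y hy
    exact (hout y hy).symm
  have h0 := hdiff.apply_eq_of_tendsto_cocompact z hlim
  simp only [hh, if_pos (hΓU (Or.inl hz))] at h0
  rw [hsplit z hz.1, sub_eq_zero] at h0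
  exact h0

theorem PositivelyOriented.contourIntegral_eq (hpos : Γ.PositivelyOriented) {z : ℂ}
    (hz : z ∈ Γ.interior) :
    Γ.contourIntegral (fun w => 1 / (w - z)) = 2 * Real.pi * Complex.I := by
  have := hpos z hz
  rw [windingNumber, inv_mul_eq_one₀ Complex.two_pi_I_ne_zero] at this
  simpa only [one_div] using this.symm

/-- Partial fractions give a difference of two integrals, both equal to `2πi`; for `l = z` the
integrand has a primitive. -/
theorem PositivelyOriented.contourIntegral_inv_sub_div_sub (hpos : Γ.PositivelyOriented)
    {l z : ℂ} (hl : l ∈ Γ.interior) (hz : z ∈ Γ.interior) :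
    Γ.contourIntegral (fun w => (w - l)⁻¹ / (w - z)) = 0 := by
  rcases eq_or_ne l z with rfl | hne
  · rw [← contourIntegral_div_sub_sq hz.1]
    congr 1
    ext w
    rw [one_div, div_eq_mul_inv, sq, mul_inv]
  · have h1 : ∀ y ∈ Γ.interior, Γ.ContourIntegrable fun w => 1 / (w - y) := fun y hy =>
      contourIntegrable_of_continuousOn (continuousOn_div_sub continuousOn_const hy.1)
    have : Γ.contourIntegral (fun w => (w - l)⁻¹ / (w - z)) =
        Γ.contourIntegral (fun w => (l - z)⁻¹ * (1 / (w - l) - 1 / (w - z))) := by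
      refine contourIntegral_congr fun w hw => ?_
      have ha := sub_ne_zero_of_mem hw hl.1
      have hb := sub_ne_zero_of_mem hw hz.1
      have hc := sub_ne_zero.2 hne
      field_simp
      ring
    rw [this, contourIntegral_const_mul, contourIntegral_sub (h1 l hl) (h1 z hz),
      hpos.contourIntegral_eq hl, hpos.contourIntegral_eq hz, sub_self, mul_zero]

end SimpleClosedCurve

/-! ### Removing the singularities of `M⁻¹` minus the principal part. -/

theorem Filter.Eventually.eventually_nhdsNE_of_nhdsNE {p : ℂ → Prop} {μ : ℂ}
    (h : ∀ᶠ z in 𝓝[≠] μ, p z) : ∀ᶠ y in 𝓝 μ, ∀ᶠ z in 𝓝[≠] y, p z := by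
  refine (eventually_nhdsWithin_iff.1 h).eventually_nhds.mono fun y hy => ?_
  have hne : ∀ᶠ z in 𝓝[≠] y, z ≠ μ := by
    rcases eq_or_ne y μ with rfl | hyμ
    · exact self_mem_nhdsWithin
    · exact nhdsWithin_le_nhds (eventually_ne_nhds hyμ)
  filter_upwards [nhdsWithin_le_nhds hy, hne] with z hz hzμ using hz hzμ

/-- Punctured limits ignore the value of `F` at the point itself, so one formula fills in every
removable singularity at once. -/
theorem analyticAt_limUnder_nhdsNE {F f : ℂ → ℂ} {μ : ℂ} (hf : AnalyticAt ℂ f μ)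
    (h : ∀ᶠ z in 𝓝[≠] μ, F z = f z) : AnalyticAt ℂ (fun z => limUnder (𝓝[≠] z) F) μ := by
  refine hf.congr ?_
  filter_upwards [hf.eventually_analyticAt, h.eventually_nhdsNE_of_nhdsNE] with y hy hFy
  exact ((hy.continuousAt.tendsto.mono_left nhdsWithin_le_nhds).congr'
    (hFy.mono fun _ hz => hz.symm)).limUnder_eq.symm

theorem ContinuousAt.limUnder_nhdsNE_eq {F : ℂ → ℂ} {μ : ℂ} (hF : ContinuousAt F μ) :
    limUnder (𝓝[≠] μ) F = F μ :=
  (hF.tendsto.mono_left nhdsWithin_le_nhds).limUnder_eq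

section

variable {n k : ℕ} {M : ℂ → Matrix (Fin n) (Fin n) ℂ} {lam : Fin k → ℂ}
  {v u : Fin k → Fin n → ℂ}

theorem keldyshSum_apply (z : ℂ) (a b : Fin n) : keldyshSum M lam v u z a b =
    ∑ i, ((z - lam i)⁻¹ * (eigenPairing M (lam i) (v i) (u i))⁻¹) *
      Matrix.vecMulVec (v i) (star (u i)) a b := by
  simp [keldyshSum, Matrix.sum_apply]

theorem analyticAt_keldysh_term {p : ℂ} {i : Fin k} (hp : p ≠ lam i) (a b : Fin n) :
    AnalyticAt ℂ (fun z => ((z - lam i)⁻¹ * (eigenPairing M (lam i) (v i) (u i))⁻¹) *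
      Matrix.vecMulVec (v i) (star (u i)) a b) p :=
  (((analyticAt_id.sub analyticAt_const).inv (sub_ne_zero.2 hp)).mul
    analyticAt_const).mul analyticAt_const

theorem analyticAt_inv_sub_keldyshSum {p : ℂ} (h : ∀ i j, AnalyticAt ℂ (fun z => M z i j) p)
    (hp : ¬ IsNEPEigenvalue M p) (hlam : p ∉ range lam) (a b : Fin n) :
    AnalyticAt ℂ (fun z => (M z)⁻¹ a b - keldyshSum M lam v u z a b) p := by
  simp only [keldyshSum_apply]
  refine (analyticAt_inv_apply h hp a b).sub (Finset.analyticAt_fun_sum _ fun i _ => ?_)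
  exact analyticAt_keldysh_term (fun h' => hlam ⟨i, h'.symm⟩) a b

theorem exists_analyticAt_inv_sub_keldyshSum {i : Fin k} (hinj : Function.Injective lam)
    (h : ∀ a b, AnalyticAt ℂ (fun z => M z a b) (lam i))
    (hs : IsSimpleEigenvalue M (lam i)) (hv : IsRightEigenvector M (lam i) (v i))
    (hu : IsLeftEigenvector M (lam i) (u i)) (a b : Fin n) :
    ∃ f : ℂ → ℂ, AnalyticAt ℂ f (lam i) ∧ ∀ᶠ z in 𝓝[≠] (lam i),
      (M z)⁻¹ a b - keldyshSum M lam v u z a b = f z := by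
  obtain ⟨f, hf, hev⟩ := exists_analyticAt_inv_sub_principalPart h hs hv hu a b
  refine ⟨fun z => f z - ∑ l ∈ Finset.univ.erase i,
    ((z - lam l)⁻¹ * (eigenPairing M (lam l) (v l) (u l))⁻¹) *
      Matrix.vecMulVec (v l) (star (u l)) a b,
    hf.sub (Finset.analyticAt_fun_sum _ fun l hl => ?_), ?_⟩
  · exact analyticAt_keldysh_term (fun h' => Finset.ne_of_mem_erase hl (hinj h').symm) a b
  · filter_upwards [hev] with z hz
    rw [← hz, keldyshSum_apply, ← Finset.add_sum_erase _ _ (Finset.mem_univ i)]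
    ring

end

/-! ### Finiteness of the spectrum and the main theorem. -/

/-- Infinitely many eigenvalues would accumulate in the compact set `Γ.interior ∪ Γ.carrier`, but
simple zeros of `det M` are isolated and non-eigenvalues form a neighborhood of each non-eigenvalue
there. -/
theorem finite_eigenvalues_interior {n : ℕ} {M : ℂ → Matrix (Fin n) (Fin n) ℂ}
    {Γ : SimpleClosedCurve} (hM : MatrixAnalyticOn M (Γ.interior ∪ Γ.carrier))
    (hΓ : ∀ w ∈ Γ.carrier, ¬ IsNEPEigenvalue M w)
    (hsimple : ∀ μ ∈ Γ.interior, IsNEPEigenvalue M μ → IsSimpleEigenvalue M μ) :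
    {μ ∈ Γ.interior | IsNEPEigenvalue M μ}.Finite := by
  by_contra hinf
  obtain ⟨p, hpK, hp⟩ := Set.Infinite.exists_accPt_of_subset_isCompact hinf
    Γ.isCompact_interior_union_carrier fun μ hμ => Or.inl hμ.1
  rw [accPt_iff_frequently_nhdsNE] at hp
  have hpa : ∀ i j, AnalyticAt ℂ (fun z => M z i j) p := fun i j => hM i j p hpK
  refine hp (Eventually.mono (p := fun z => ¬ IsNEPEigenvalue M z) ?_ fun z hz h => hz h.2)
  by_cases hpe : IsNEPEigenvalue M p
  · rcases hpK with hpi | hpc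
    · exact (hsimple p hpi hpe).eventually_not_isNEPEigenvalue hpa
    · exact absurd hpe (hΓ p hpc)
  · simp only [isNEPEigenvalue_iff] at hpe ⊢
    exact nhdsWithin_le_nhds ((AnalyticAt.matrix_det hpa).continuousAt.eventually_ne hpe)

theorem lemma1 {n : ℕ} (Ω : Set ℂ) (M : ℂ → Matrix (Fin n) (Fin n) ℂ)
    (hM : MatrixAnalyticOn M Ω)
    (Γ : SimpleClosedCurve) (hpos : Γ.PositivelyOriented)
    (hΓΩ : Γ.carrier ⊆ Ω) (hintΩ : Γ.interior ⊆ Ω)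
    (hΓ : ∀ w ∈ Γ.carrier, ¬ IsNEPEigenvalue M w)
    (hsimple : ∀ μ ∈ Γ.interior, IsNEPEigenvalue M μ → IsSimpleEigenvalue M μ) :
    {μ ∈ Γ.interior | IsNEPEigenvalue M μ}.Finite ∧
    ∀ (k : ℕ) (lam : Fin k → ℂ) (v u : Fin k → Fin n → ℂ),
      Function.Injective lam →
      Set.range lam = {μ ∈ Γ.interior | IsNEPEigenvalue M μ} →
      (∀ i, IsRightEigenvector M (lam i) (v i)) →
      (∀ i, IsLeftEigenvector M (lam i) (u i)) →
      (∀ i, eigenPairing M (lam i) (v i) (u i) ≠ 0) ∧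
      (∃ R, IsKeldyshRemainder M Γ lam v u R) ∧
      (∀ R, IsKeldyshRemainder M Γ lam v u R →
        ∀ z ∈ Γ.interior,
          (∀ i j, Γ.ContourIntegrable (fun w => (M w)⁻¹ i j / (w - z))) ∧
          R z = cauchyInverse M Γ z) := by
  have hMa : ∀ p ∈ Γ.interior ∪ Γ.carrier, ∀ i j, AnalyticAt ℂ (fun z => M z i j) p :=
    fun p hp i j => hM i j p (union_subset hintΩ hΓΩ hp)
  refine ⟨finite_eigenvalues_interior (fun i j p hp => hMa p hp i j) hΓ hsimple, ?_⟩
  intro k lam v u hinj hrange hv hu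
  have hlam : ∀ i, lam i ∈ Γ.interior ∧ IsNEPEigenvalue M (lam i) := fun i => by
    have : lam i ∈ range lam := mem_range_self i
    rwa [hrange] at this
  have hlams : ∀ i, IsSimpleEigenvalue M (lam i) := fun i => hsimple _ (hlam i).1 (hlam i).2
  have hnot : ∀ p ∈ Γ.interior ∪ Γ.carrier, p ∉ range lam → ¬ IsNEPEigenvalue M p := by
    rintro p (hp | hp) hpl hpe
    · exact hpl (hrange ▸ ⟨hp, hpe⟩)
    · exact hΓ p hp hpe
  have hcar : ∀ w ∈ Γ.carrier, w ∉ range lam := by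
    rintro w hw hwl
    rw [hrange] at hwl
    exact hΓ w hw hwl.2
  set F : Fin n → Fin n → ℂ → ℂ := fun a b z => (M z)⁻¹ a b - keldyshSum M lam v u z a b with hF
  -- At `lam i`, `F` has a meaningless value, since inverses of singular matrices and of `0` are `0`
  -- by convention; the punctured limit replaces it.
  set S : Fin n → Fin n → ℂ → ℂ := fun a b z => limUnder (𝓝[≠] z) (F a b) with hS
  have hFa : ∀ a b, ∀ p ∈ Γ.interior ∪ Γ.carrier, p ∉ range lam → AnalyticAt ℂ (F a b) p :=
    fun a b p hp hpl => analyticAt_inv_sub_keldyshSum (hMa p hp) (hnot p hp hpl) hpl a b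
  have hSF : ∀ a b, ∀ p ∈ Γ.interior ∪ Γ.carrier, p ∉ range lam → S a b p = F a b p :=
    fun a b p hp hpl => (hFa a b p hp hpl).continuousAt.limUnder_nhdsNE_eq
  have hSa : ∀ a b, ∀ p ∈ Γ.interior ∪ Γ.carrier, AnalyticAt ℂ (S a b) p := by
    intro a b p hp
    by_cases hpl : p ∈ range lam
    · obtain ⟨i, rfl⟩ := hpl
      obtain ⟨f, hf, hev⟩ :=
        exists_analyticAt_inv_sub_keldyshSum hinj (hMa _ hp) (hlams i) (hv i) (hu i) a b
      exact analyticAt_limUnder_nhdsNE hf hev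
    · exact analyticAt_limUnder_nhdsNE (hFa a b p hp hpl) (Eventually.of_forall fun _ => rfl)
  refine ⟨fun i => eigenPairing_ne_zero (hMa _ (Or.inl (hlam i).1)) (hlams i) (hv i) (hu i),
    ⟨fun z => Matrix.of fun a b => S a b z, fun a b z hz => hSa a b z (Or.inl hz),
      fun z hz => ?_⟩, ?_⟩
  · ext a b
    simp only [Matrix.add_apply, Matrix.of_apply, hSF a b z (Or.inl hz.1) hz.2, hF]
    ring
  intro R hR z hz
  have hinvc : ∀ a b, ContinuousOn (fun w => (M w)⁻¹ a b) Γ.carrier := fun a b w hw =>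
    (analyticAt_inv_apply (hMa w (Or.inr hw)) (hΓ w hw) a b).continuousAt.continuousWithinAt
  refine ⟨fun a b => SimpleClosedCurve.contourIntegrable_of_continuousOn
    (SimpleClosedCurve.continuousOn_div_sub (hinvc a b) hz.1), ?_⟩
  ext a b
  -- The defining equation says nothing about `R` at the eigenvalues; continuity of `R` and `S`
  -- carries their equality there.
  have hRS : R z a b = S a b z := by
    have h1 : ContinuousAt (fun w => R w a b) z := (hR.1 a b z hz).continuousAt
    have h2 : ContinuousAt (S a b) z := (hSa a b z (Or.inl hz)).continuousAt
    refine ((h1.eventuallyEq_nhds_iff_eventuallyEq_nhdsNE h2).1 ?_).self_of_nhds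
    have hfin : (range lam \ {z})ᶜ ∈ 𝓝 z :=
      ((finite_range lam).subset sdiff_subset).isClosed.isOpen_compl.mem_nhds fun h => h.2 rfl
    filter_upwards [nhdsWithin_le_nhds hfin, self_mem_nhdsWithin,
      nhdsWithin_le_nhds (Γ.isOpen_interior.mem_nhds hz)] with w hw hwz hwi
    have hwl : w ∉ range lam := fun h => hw ⟨h, hwz⟩
    rw [hSF a b w (Or.inl hwi) hwl]
    simp only [hF, hR.2 w ⟨hwi, hwl⟩, Matrix.add_apply]
    ring
  have hSc : ContinuousOn (S a b) Γ.carrier := fun w hw =>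
    (hSa a b w (Or.inr hw)).continuousAt.continuousWithinAt
  have hterm : ∀ l, Γ.ContourIntegrable (fun w => (w - lam l)⁻¹ / (w - z)) := fun l =>
    SimpleClosedCurve.contourIntegrable_of_continuousOn
      (SimpleClosedCurve.continuousOn_div_sub (ContinuousOn.inv₀ (by fun_prop)
        fun w hw => SimpleClosedCurve.sub_ne_zero_of_mem hw (hlam l).1.1) hz.1)
  set c : Fin k → ℂ := fun l => (eigenPairing M (lam l) (v l) (u l))⁻¹ *
    Matrix.vecMulVec (v l) (star (u l)) a b with hc
  have hcterm : ∀ l ∈ Finset.univ,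
      Γ.ContourIntegrable (fun w => c l * ((w - lam l)⁻¹ / (w - z))) := fun l _ => by
    have := IntervalIntegrable.const_mul (hterm l) (c l)
    simpa only [SimpleClosedCurve.ContourIntegrable, mul_assoc] using this
  have hsum : Γ.ContourIntegrable (fun w => ∑ l, c l * ((w - lam l)⁻¹ / (w - z))) := by
    have := IntervalIntegrable.sum Finset.univ hcterm
    refine this.congr fun t _ => ?_
    simp [Finset.sum_mul]
  have hdecomp : Γ.contourIntegral (fun w => (M w)⁻¹ a b / (w - z)) =
      Γ.contourIntegral (fun w => S a b w / (w - z) +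
        ∑ l, c l * ((w - lam l)⁻¹ / (w - z))) := by
    refine SimpleClosedCurve.contourIntegral_congr fun w hw => ?_
    simp only [hSF a b w (Or.inr hw) (hcar w hw), hF, keldyshSum_apply, hc]
    rw [sub_div, Finset.sum_div, sub_add, ← Finset.sum_sub_distrib, Finset.sum_eq_zero, sub_zero]
    intro l _
    ring
  rw [hRS, cauchyInverse, Matrix.of_apply, hdecomp, SimpleClosedCurve.contourIntegral_add
    (SimpleClosedCurve.contourIntegrable_of_continuousOn
      (SimpleClosedCurve.continuousOn_div_sub hSc hz.1)) hsum,
    SimpleClosedCurve.contourIntegral_finset_sum _ hcterm]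
  simp only [SimpleClosedCurve.contourIntegral_const_mul,
    hpos.contourIntegral_inv_sub_div_sub (hlam _).1 hz, mul_zero, Finset.sum_const_zero, add_zero]
  -- `Ω` need not be open, so Cauchy's formula is applied on the set of points where `S a b` is
  -- analytic, which is always open.
  rw [SimpleClosedCurve.contourIntegral_div_sub_eq (isOpen_analyticAt ℂ (S a b))
    (fun p hp => hSa a b p hp) (fun p hp => hp) hz, hpos.contourIntegral_eq hz,
    mul_comm (S a b z), inv_mul_cancel_left₀ Complex.two_pi_I_ne_zero]
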